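/- All systems are finite-dimensional and non-zero. For a system $B$ let $\mathbf{u}^B=I^B/|B|$ be the uniform (maximally mixed) state; a channel is a completely positive trace-preserving map, and an isometry $V$ is identified with the channel $\mathcal{V}(\cdot)=V(\cdot)V^\dagger$. Definitions. A channel $\mathcal{E}^{RB\to B}$ is *conditionally unital* if for every state $\tau^R$ the map $\omega^B\mapsto\mathcal{E}(\tau^R\otimes\omega^B)$ is a doubly stochastic channel, i.e. a channel that fixes $\mathbf{u}^B$. A channel $\mathcal{N}^{A'B\to AB}$ is *conditionally unital* if for every state $\rho^{A'}$ there is a state $\sigma^A$ with $\mathcal{N}(\rho^{A'}\otimes\mathbf{u}^B)=\sigma^A\otimes\mathbf{u}^B$; it is *$B\not\to A$ signalling* if the reduced output state on $A$ depends only on the reduced input state on $A'$; it is *conditionally mixing* if it is both $B\not\to A$ signalling and conditionally unital. A *superchannel* from $A\to B$ to $A'\to B$ is a linear map $\Theta$ from linear maps $\mathcal F^{A\to B}$ of operators to linear maps of operators $A'\to B$ such that, for all systems $C,D$, $\Theta\otimes\mathbb{1}^{(C\to D)}$ sends channels $AC\to BD$ to channels $A'C\to BD$. A *realization* of $\Theta$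 consists of a system $R$, an isometry $\mathcal{V}^{A'\to RA}$ and a channel $\mathcal{E}^{RB\to B}$ with $$\Theta[\mathcal{F}^{A\to B}]=\mathcal{E}^{RB\to B}\circ\mathcal{F}^{A\to B}\circ\mathcal{V}^{A'\to RA}\quad\text{for all linear }\mathcal{F}^{A\to B},$$ and it is a *standard form* if $|R|$ is the least possible. A superchannel is *mixing* if it has a standard form in which $\mathcal{E}$ is conditionally unital. Theorem 14. Let $A'$, $A$, $B$ be systems. (1) A channel $\mathcal{N}^{A'B\to AB}$ is $B\not\to A$ signalling if and only if it has the form $$\mathcal{N}^{A'B\to AB}=\mathcal{E}^{RB\to B}\circ\mathcal{V}^{A'\to RA}\qquad(*)$$ for some system $R$, isometry $\mathcal{V}$ and channel $\mathcal{E}$. (2) A channel $\mathcal{N}^{A'B\to AB}$ is conditionally mixing if and only if it has the form $(*)$ with $\mathcal{V}$ an isometry and $\mathcal{E}$ a conditionally unital channel. (3) Every superchannel from $A\to B$ to $A'\to B$ has a realization. The map $\mathbf{f}(\Theta)=\mathcal{E}^{RB\to B}\circ\mathcal{V}^{A'\to RA}$, where $(R,\mathcal{V},\mathcal{E})$ is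 a realization of $\Theta$, does not depend on the choice of the realization, is a bijection from the set of these superchannels onto the set of $B\not\to A$ signalling channels $A'B\to AB$, and restricts to a bijection from the set of mixing superchannels onto the set of conditionally mixing channels $A'B\to AB$. -/

import Mathlib

open scoped Kronecker Matrix ComplexOrder

namespace QMix

/-- Linear maps from the operators on the system with basis `X` to those on the system with
basis `Y` (a finite-dimensional system is given by the finite type labelling its basis, a
composite system by the product of the types). -/
abbrev Superop (X Y : Type*) := Matrix X X ℂ →ₗ[ℂ] Matrix Y Y ℂ

/-- Supermaps: linear maps from superoperators `X → Y` to superoperators `X' → Y'`. -/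
abbrev Supermap (X Y X' Y' : Type*) := Superop X Y →ₗ[ℂ] Superop X' Y'

section Basic

variable {X Y C : Type*}

/-- Renaming of basis labels, used to reorder tensor factors. -/
def relabel (e : X ≃ Y) : Superop X Y :=
  (Matrix.reindexLinearEquiv ℂ ℂ e e).toLinearMap

/-- The block `⟨c| M |c'⟩` of an operator `M` on `XC`. -/
def block (c c' : C) : Matrix (X × C) (X × C) ℂ →ₗ[ℂ] Matrix X X ℂ where
  toFun M := Matrix.of fun x x' => M (x, c) (x', c')
  map_add' _ _ := rfl
  map_smul' _ _ := rfl

/-- `Φ ⊗ id_C`, which applies `Φ` to each block. -/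
def ampliate (C : Type*) (Φ : Superop X Y) : Superop (X × C) (Y × C) where
  toFun M := Matrix.of fun p q => Φ (block p.2 q.2 M) p.1 q.1
  map_add' M N := by
    ext p q
    simp
  map_smul' a M := by
    ext p q
    simp

/-- Partial trace over the second tensor factor. -/
def traceSnd [Fintype Y] (M : Matrix (X × Y) (X × Y) ℂ) : Matrix X X ℂ :=
  Matrix.of fun x x' => ∑ y, M (x, y) (x', y)

/-- Density matrices. -/
def IsState [Fintype X] (ρ : Matrix X X ℂ) : Prop := ρ.PosSemidef ∧ ρ.trace = 1

/-- The uniform (maximally mixed) state. -/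
noncomputable def unif (X : Type*) [Fintype X] [DecidableEq X] : Matrix X X ℂ :=
  (Fintype.card X : ℂ)⁻¹ • 1

def IsCompletelyPositive (Φ : Superop X Y) : Prop :=
  ∀ (k : ℕ) (M : Matrix (X × Fin k) (X × Fin k) ℂ),
    M.PosSemidef → (ampliate (Fin k) Φ M).PosSemidef

def IsTracePreserving [Fintype X] [Fintype Y] (Φ : Superop X Y) : Prop :=
  ∀ M, (Φ M).trace = M.trace

/-- Quantum channels (CPTP maps). -/
def IsChannel [Fintype X] [Fintype Y] (Φ : Superop X Y) : Prop :=
  IsCompletelyPositive Φ ∧ IsTracePreserving Φ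

/-- Doubly stochastic maps: channels that fix the uniform state. -/
def IsDoublyStochastic [Fintype X] [DecidableEq X] (Φ : Superop X X) : Prop :=
  IsChannel Φ ∧ Φ (unif X) = unif X

/-- Isometries between the Hilbert spaces with bases `X` and `Y`. -/
def IsIsometry [Fintype Y] [DecidableEq X] (V : Matrix Y X ℂ) : Prop := Vᴴ * V = 1

/-- `ρ ↦ V ρ V†`. -/
def conjBy [Fintype X] (V : Matrix Y X ℂ) : Superop X Y where
  toFun ρ := V * ρ * Vᴴ
  map_add' M N := by rw [Matrix.mul_add, Matrix.add_mul]
  map_smul' c M := by simp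

end Basic

section Bipartite

variable {R A' A B : Type*}

/-- The map `ω ↦ E (τ ⊗ ω)`. -/
def withSideState (E : Superop (R × B) B) (τ : Matrix R R ℂ) : Superop B B where
  toFun ω := E (τ ⊗ₖ ω)
  map_add' M N := by rw [Matrix.kronecker_add, map_add]
  map_smul' c M := by rw [Matrix.kronecker_smul, map_smul, RingHom.id_apply]

/-- A map `E : RB → B` is conditionally unital if `E (τ ⊗ ·)` is doubly stochastic for every
state `τ` of `R`. -/
def IsConditionallyUnitalPost [Fintype R] [Fintype B] [DecidableEq B]
    (E : Superop (R × B) B) : Prop :=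
  ∀ τ : Matrix R R ℂ, IsState τ → IsDoublyStochastic (withSideState E τ)

/-- A bipartite map `N : A'B → AB` is conditionally unital if it sends `ρ ⊗ u` to some `σ ⊗ u`,
for every state `ρ` of `A'`. -/
def IsConditionallyUnital [Fintype A'] [Fintype A] [Fintype B] [DecidableEq B]
    (N : Superop (A' × B) (A × B)) : Prop :=
  ∀ ρ : Matrix A' A' ℂ, IsState ρ →
    ∃ σ : Matrix A A ℂ, IsState σ ∧ N (ρ ⊗ₖ unif B) = σ ⊗ₖ unif B

/-- No signalling from `B` to `A`: the reduced output on `A` depends only on the reduced input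
on `A'`. -/
def IsNonSignalling [Fintype A'] [Fintype B] (N : Superop (A' × B) (A × B)) : Prop :=
  ∀ ρ₁ ρ₂ : Matrix (A' × B) (A' × B) ℂ, IsState ρ₁ → IsState ρ₂ →
    traceSnd ρ₁ = traceSnd ρ₂ → traceSnd (N ρ₁) = traceSnd (N ρ₂)

/-- Conditionally mixing channels. -/
def IsConditionallyMixing [Fintype A'] [Fintype A] [Fintype B] [DecidableEq B]
    (N : Superop (A' × B) (A × B)) : Prop :=
  IsChannel N ∧ IsNonSignalling N ∧ IsConditionallyUnital N

/-- `(R × A) × B ≃ (R × B) × A`. -/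
def shuffle (R A B : Type*) : (R × A) × B ≃ (R × B) × A where
  toFun p := ((p.1.1, p.2), p.1.2)
  invFun p := ((p.1.1, p.2), p.1.2)
  left_inv _ := rfl
  right_inv _ := rfl

/-- The bipartite map `E^{RB → B} ∘ V^{A' → RA}` from `A'B` to `AB`: first `V ⊗ id_B`, then
`E ⊗ id_A`. -/
def semilocal [Fintype A'] (V : Matrix (R × A) A' ℂ) (E : Superop (R × B) B) :
    Superop (A' × B) (A × B) :=
  relabel (Equiv.prodComm B A) ∘ₗ ampliate A E ∘ₗ relabel (shuffle R A B) ∘ₗ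
    ampliate B (conjBy V)

/-- The map `E^{RB → B} ∘ (id_R ⊗ F^{A → B}) ∘ V^{A' → RA}` from `A'` to `B`. -/
def prePost [Fintype A'] (V : Matrix (R × A) A' ℂ) (E : Superop (R × B) B)
    (F : Superop A B) : Superop A' B :=
  E ∘ₗ relabel (Equiv.prodComm B R) ∘ₗ ampliate R F ∘ₗ relabel (Equiv.prodComm R A) ∘ₗ
    conjBy V

end Bipartite

section Supermaps

variable {X Y X' Y' C D : Type*}

/-- The component `x ↦ ⟨d| F (x ⊗ |c⟩⟨c'|) |d'⟩` of a map `F : XC → YD`. -/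
def component [DecidableEq C] (F : Superop (X × C) (Y × D)) (c c' : C) (d d' : D) :
    Superop X Y where
  toFun M := Matrix.of fun y y' => F (M ⊗ₖ Matrix.single c c' (1 : ℂ)) (y, d) (y', d')
  map_add' M N := by
    ext y y'
    simp [Matrix.add_kronecker]
  map_smul' a M := by
    ext y y'
    simp [Matrix.smul_kronecker]

/-- `(Θ ⊗ 𝟙^{(C → D)})[F]`: the supermap `Θ` acts on each component of `F`. -/
def superAmpliate [Fintype C] [DecidableEq C] (Θ : Supermap X Y X' Y')
    (F : Superop (X × C) (Y × D)) : Superop (X' × C) (Y' × D) where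
  toFun M := Matrix.of fun p q => ∑ c, ∑ c',
    Θ (component F c c' p.2 q.2) (block c c' M) p.1 q.1
  map_add' M N := by
    ext p q
    simp [Finset.sum_add_distrib]
  map_smul' a M := by
    ext p q
    simp [Finset.mul_sum]

/-- Superchannels: supermaps `Θ` such that `Θ ⊗ 𝟙^{(C → D)}` sends channels to channels, for
all ancillary systems `C` and `D`. -/
def IsSuperchannel [Fintype X] [Fintype Y] [Fintype X'] [Fintype Y']
    (Θ : Supermap X Y X' Y') : Prop :=
  ∀ (k l : ℕ) (F : Superop (X × Fin k) (Y × Fin l)),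
    IsChannel F → IsChannel (superAmpliate Θ F)

variable {R A' A B : Type*}

/-- `Θ` is implemented by the isometry `V : A' → RA` and the channel `E : RB → B`. -/
def IsRealization [Fintype A'] [DecidableEq A'] [Fintype A] [Fintype B] [Fintype R]
    (Θ : Supermap A B A' B) (V : Matrix (R × A) A' ℂ) (E : Superop (R × B) B) : Prop :=
  IsIsometry V ∧ IsChannel E ∧ ∀ F : Superop A B, Θ F = prePost V E F

/-- Standard form: a realization whose auxiliary system has the least possible dimension. -/
def IsStandardForm [Fintype A'] [DecidableEq A'] [Fintype A] [Fintype B]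
    (Θ : Supermap A B A' B) (r : ℕ) (V : Matrix (Fin r × A) A' ℂ)
    (E : Superop (Fin r × B) B) : Prop :=
  IsRealization Θ V E ∧
    ∀ (r' : ℕ) (V' : Matrix (Fin r' × A) A' ℂ) (E' : Superop (Fin r' × B) B),
      IsRealization Θ V' E' → r ≤ r'

/-- Mixing superchannels: the post-processing of the standard form is conditionally unital. -/
def IsMixing [Fintype A'] [DecidableEq A'] [Fintype A] [Fintype B] [DecidableEq B]
    (Θ : Supermap A B A' B) : Prop :=
  IsSuperchannel Θ ∧ ∃ (r : ℕ) (V : Matrix (Fin r × A) A' ℂ) (E : Superop (Fin r × B) B),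
    IsStandardForm Θ r V E ∧ IsConditionallyUnitalPost E

end Supermaps

end QMix

/-! The map `f` is `toBipartite`: apply `Θ` to the swap `AB → BA`. A realization `E ∘ F ∘ V` then
yields `E ∘ V`, yet the definition mentions no realization. The components of the swap are matrix
units of the space of maps `A → B`, so the values of `Θ` on a spanning set can be read off, and
`toBipartite` is injective on all supermaps (`toBipartite_injective`).

The image of a superchannel is a channel because the swap is one. It is non-signalling because `Θ`
takes measure-and-prepare channels to trace-preserving maps: the statistics on `A` cannot depend on
the state prepared on `B` (`IsSuperchannel.isNonSignalling_toBipartite`).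

Conversely, let `N` be a non-signalling channel with Kraus operators `K i`. Reshape them into one
matrix with rows `(i, b)`, where `b` is the output on `B`. Its Gram matrix is the Choi matrix of the
reduced map, up to transposition, and non-signalling says exactly that it is `G ⊗ 1` over the input
`B`. Factor `G = Lᴴ * L` with `L` of full row rank. Equal Gram matrices differ by an isometry `W`;
reshaping `L` gives `V`, and slicing `W` gives the Kraus operators of `E`
(`IsNonSignalling.exists_semilocal`). Injectivity turns this into the existence of realizations.

For the mixing statements, minimality of a standard form forces the vectors `⟨a|V|x⟩` to span `R`
(`IsStandardForm.exists_rightInverse`). Every state of `R` is thus a sum of operators `⟨a|V X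
V†|a'⟩`. On such an operator tensored with the uniform state, `E` returns a block of `N (X ⊗ u)`,
which is a multiple of `u` when `N` is conditionally unital. The trace fixes the multiple
(`isConditionallyUnitalPost_of_rightInverse`). -/

namespace QMix

/-! ### Blocks, ampliations and partial traces -/

section Structural

variable {X Y Z C D : Type*}

@[simp] lemma block_apply (c c' : C) (M : Matrix (X × C) (X × C) ℂ) (x x' : X) :
    block c c' M x x' = M (x, c) (x', c') := rfl

@[simp] lemma ampliate_apply (Φ : Superop X Y) (M : Matrix (X × C) (X × C) ℂ) (p q : Y × C) :
    ampliate C Φ M p q = Φ (block p.2 q.2 M) p.1 q.1 := rfl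

@[simp] lemma relabel_apply (e : X ≃ Y) (M : Matrix X X ℂ) (y y' : Y) :
    relabel e M y y' = M (e.symm y) (e.symm y') := rfl

@[simp] lemma conjBy_apply [Fintype X] (V : Matrix Y X ℂ) (M : Matrix X X ℂ) :
    conjBy V M = V * M * Vᴴ := rfl

@[simp] lemma traceSnd_apply [Fintype Y] (M : Matrix (X × Y) (X × Y) ℂ) (x x' : X) :
    traceSnd M x x' = ∑ y, M (x, y) (x', y) := rfl

lemma block_ampliate (Φ : Superop X Y) (M : Matrix (X × C) (X × C) ℂ) (c c' : C) :
    block c c' (ampliate C Φ M) = Φ (block c c' M) := rfl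

lemma ampliate_comp (Φ : Superop Y Z) (Ψ : Superop X Y) :
    ampliate C (Φ ∘ₗ Ψ) = ampliate C Φ ∘ₗ ampliate C Ψ := rfl

lemma trace_eq_sum_block [Fintype X] [Fintype C] (M : Matrix (X × C) (X × C) ℂ) :
    M.trace = ∑ c, (block c c M).trace := by
  simp only [Matrix.trace, Matrix.diag_apply, block_apply, Fintype.sum_prod_type]
  exact Finset.sum_comm

lemma trace_traceSnd [Fintype X] [Fintype C] (M : Matrix (X × C) (X × C) ℂ) :
    (traceSnd M).trace = M.trace := by
  simp [Matrix.trace, Fintype.sum_prod_type]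

lemma traceSnd_eq_sum_block [Fintype C] (M : Matrix (X × C) (X × C) ℂ) :
    traceSnd M = ∑ c, block c c M := by
  ext x x'
  simp [Matrix.sum_apply]

lemma eq_sum_block_kronecker [Fintype C] [DecidableEq C] (M : Matrix (X × C) (X × C) ℂ) :
    M = ∑ c, ∑ c', block c c' M ⊗ₖ Matrix.single c c' (1 : ℂ) := by
  ext ⟨x, c⟩ ⟨x', c'⟩
  simp only [Matrix.sum_apply, Matrix.kroneckerMap_apply, block_apply]
  rw [Finset.sum_eq_single c, Finset.sum_eq_single c']
  · simp
  · intro b _ hb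
    simp [hb]
  · simp
  · intro b _ hb
    simp [hb]
  · simp

lemma block_kronecker (M : Matrix X X ℂ) (N : Matrix C C ℂ) (c c' : C) :
    block c c' (M ⊗ₖ N) = N c c' • M := by
  ext x x'
  simp [mul_comm]

lemma traceSnd_kronecker [Fintype C] (M : Matrix X X ℂ) (N : Matrix C C ℂ) :
    traceSnd (M ⊗ₖ N) = N.trace • M := by
  ext x x'
  simp [Matrix.trace, ← Finset.mul_sum, mul_comm]

end Structural

/-! ### Factorizations and isometries between matrices with equal Gram matrix -/

section Factorization

variable {m n : Type*}

lemma exists_eq_conjTranspose_mul_self [Fintype n] {M : Matrix n n ℂ} (hM : M.PosSemidef) :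
    ∃ (k : ℕ) (B : Matrix (Fin k) n ℂ), M = Bᴴ * B := by
  obtain ⟨k, v, rfl⟩ := Matrix.posSemidef_iff_eq_sum_vecMulVec.mp hM
  refine ⟨k, Matrix.of fun i x => star (v i x), ?_⟩
  ext x y
  simp [Matrix.sum_apply, Matrix.mul_apply, Matrix.vecMulVec_apply]

/-- Every matrix `B` factors through an isometry onto its range. -/
lemma exists_isometry_onto_range [Fintype n] [Fintype m] [DecidableEq m] (B : Matrix n m ℂ) :
    ∃ (r : ℕ) (Q : Matrix n (Fin r) ℂ) (P : Matrix m (Fin r) ℂ),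
      Qᴴ * Q = 1 ∧ Q * Qᴴ * B = B ∧ Qᴴ * B * P = 1 := by
  classical
  let T : (m → ℂ) →ₗ[ℂ] EuclideanSpace ℂ n :=
    (WithLp.linearEquiv 2 ℂ (n → ℂ)).symm.toLinearMap ∘ₗ B.mulVecLin
  let W := LinearMap.range T
  let b := stdOrthonormalBasis ℂ W
  -- The columns of `Q` are an orthonormal basis of the column space of `B`; preimages of these
  -- columns form `P`, so that `B * P = Q`.
  have hp : ∀ j, ∃ p : m → ℂ, T p = (b j : EuclideanSpace ℂ n) := fun j => (b j).2
  choose p hp using hp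
  let Q : Matrix n (Fin (Module.finrank ℂ W)) ℂ := Matrix.of fun i j => (b j : EuclideanSpace ℂ n) i
  let P : Matrix m (Fin (Module.finrank ℂ W)) ℂ := Matrix.of fun i j => p j i
  have hBP : B * P = Q := by
    ext i j
    have := congrArg (fun v : EuclideanSpace ℂ n => v i) (hp j)
    simpa [T, Matrix.mul_apply, Matrix.mulVec, dotProduct, P, Q] using this
  have hQ : Qᴴ * Q = 1 := by
    ext i j
    have := (orthonormal_iff_ite.mp b.orthonormal) i j
    rw [Matrix.one_apply, ← this]
    simp [Matrix.mul_apply, Q, PiLp.inner_apply, mul_comm]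
  have hQB : Q * Qᴴ * B = B := by
    ext i k
    let w : W := ⟨T (Pi.single k 1), LinearMap.mem_range_self _ _⟩
    have hw : ∀ i, (w : EuclideanSpace ℂ n) i = B i k := by
      intro i
      simp [w, T]
    have h := congrArg (fun v : W => (v : EuclideanSpace ℂ n) i) (b.sum_repr' w)
    simp only [hw] at h
    rw [← h, Matrix.mul_assoc]
    simp [Matrix.mul_apply, Q, PiLp.inner_apply, hw, mul_comm]
  exact ⟨_, Q, P, hQ, hQB, by rw [Matrix.mul_assoc, hBP, hQ]⟩

/-- If `K` and `L` have the same Gram matrix and `L` has a right inverse, then `K` is obtained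
from `L` by an isometry. -/
lemma exists_isometry_of_gram_eq {k l : Type*} [Fintype k] [Fintype l] [Fintype m]
    [DecidableEq l] [DecidableEq m] {K : Matrix k m ℂ} {L : Matrix l m ℂ} {P : Matrix m l ℂ}
    (hLP : L * P = 1) (h : Kᴴ * K = Lᴴ * L) :
    ∃ W : Matrix k l ℂ, Wᴴ * W = 1 ∧ W * L = K := by
  -- Multiplying `W * L = K` by `P` on the right leaves no other choice of `W`.
  refine ⟨K * P, ?_, ?_⟩
  · calc (K * P)ᴴ * (K * P) = Pᴴ * (Kᴴ * K) * P := by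
          simp only [Matrix.conjTranspose_mul, Matrix.mul_assoc]
      _ = (L * P)ᴴ * (L * P) := by
          rw [h]
          simp only [Matrix.conjTranspose_mul, Matrix.mul_assoc]
      _ = 1 := by simp [hLP]
  -- `K * (P * L - 1)` has the same Gram matrix as `L * (P * L - 1)`, which is zero.
  · have h0 : (K * (P * L - 1))ᴴ * (K * (P * L - 1)) = 0 := by
      calc (K * (P * L - 1))ᴴ * (K * (P * L - 1))
          = (P * L - 1)ᴴ * (Kᴴ * K) * (P * L - 1) := by
            simp only [Matrix.conjTranspose_mul, Matrix.mul_assoc]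
        _ = (P * L - 1)ᴴ * Lᴴ * (L * P * L - L) := by
            rw [h, Matrix.mul_assoc, Matrix.mul_assoc, Matrix.mul_assoc, Matrix.mul_sub,
              Matrix.mul_one, ← Matrix.mul_assoc L]
        _ = 0 := by simp [hLP]
    have h1 := Matrix.conjTranspose_mul_self_eq_zero.mp h0
    rw [Matrix.mul_sub, Matrix.mul_one, sub_eq_zero] at h1
    rw [Matrix.mul_assoc, h1]

end Factorization

/-! ### States span the space of operators -/

section Spanning

variable {X : Type*} [Fintype X]

lemma isState_unif [DecidableEq X] [Nonempty X] : IsState (unif X) := by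
  refine ⟨Matrix.PosSemidef.one.smul (by positivity), ?_⟩
  simp [unif, Matrix.trace_smul]

lemma isState_single [DecidableEq X] (x : X) : IsState (Matrix.single x x (1 : ℂ)) := by
  refine ⟨?_, by simp⟩
  convert Matrix.posSemidef_vecMulVec_self_star (Pi.single x (1 : ℂ)) using 1
  ext i j
  simp only [Matrix.single_apply, Matrix.vecMulVec_apply, Pi.single_apply, Pi.star_apply]
  by_cases hi : x = i <;> by_cases hj : x = j <;> simp [hi, hj, eq_comm]

variable {E : Type*} [AddCommGroup E] [Module ℂ E]

lemma linearMap_ext_posSemidef [DecidableEq X] {f g : Matrix X X ℂ →ₗ[ℂ] E}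
    (h : ∀ ρ : Matrix X X ℂ, ρ.PosSemidef → f ρ = g ρ) : f = g := by
  ext1 M
  let S (w : ℂ) : Matrix X X ℂ := (M + w • 1)ᴴ * (M + w • 1)
  have hS : ∀ w, f (S w) = g (S w) := fun w => h _ (Matrix.posSemidef_conjTranspose_mul_self _)
  -- Polarization: in the sum of `w • S w` over the fourth roots of unity, only the terms in `M`
  -- survive.
  have hM : M = (4⁻¹ : ℂ) • (S 1 - S (-1) + Complex.I • S Complex.I
      - Complex.I • S (-Complex.I)) := by
    ext i j
    simp only [S, Matrix.conjTranspose_add, Matrix.conjTranspose_smul, Matrix.conjTranspose_one,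
      Matrix.add_mul, Matrix.mul_add, Matrix.smul_mul, Matrix.mul_smul, Matrix.one_mul,
      Matrix.mul_one, Matrix.add_apply, Matrix.sub_apply, Matrix.smul_apply, smul_eq_mul,
      Complex.star_def, map_one, map_neg, Complex.conj_I]
    ring_nf
    simp only [Complex.I_sq]
    ring
  rw [hM]
  simp only [map_smul, map_add, map_sub, hS]

/-- Two linear maps that agree on all states are equal. -/
lemma linearMap_ext_isState [DecidableEq X] {f g : Matrix X X ℂ →ₗ[ℂ] E}
    (h : ∀ ρ : Matrix X X ℂ, IsState ρ → f ρ = g ρ) : f = g := by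
  refine linearMap_ext_posSemidef fun ρ hρ => ?_
  by_cases h0 : ρ.trace = 0
  · rw [hρ.trace_eq_zero_iff.mp h0, map_zero, map_zero]
  · have hs : IsState (ρ.trace⁻¹ • ρ) :=
      ⟨hρ.smul (inv_nonneg.mpr hρ.trace_nonneg), by simp [Matrix.trace_smul, h0]⟩
    have := h _ hs
    rw [map_smul, map_smul] at this
    exact smul_right_injective E (inv_ne_zero h0) this

end Spanning

/-! ### Completely positive maps, Kraus operators and channels -/

section Channels

variable {X Y Z C : Type*}

/-- Complete positivity is defined with ancillas `Fin k` only; a bijection of labels carries it to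
every finite ancilla. -/
lemma IsCompletelyPositive.ampliate_posSemidef [Fintype C] {Φ : Superop X Y}
    (h : IsCompletelyPositive Φ) {M : Matrix (X × C) (X × C) ℂ} (hM : M.PosSemidef) :
    (ampliate C Φ M).PosSemidef := by
  let e := Fintype.equivFin C
  convert (h _ _ (hM.submatrix (Prod.map id e.symm))).submatrix (Prod.map id e) using 1
  ext p q
  have : block p.2 q.2 M = block (e p.2) (e q.2)
      (M.submatrix (Prod.map id e.symm) (Prod.map id e.symm)) := by
    ext x x'
    simp
  simp [this]

lemma IsCompletelyPositive.comp {Φ : Superop Y Z} {Ψ : Superop X Y}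
    (hΦ : IsCompletelyPositive Φ) (hΨ : IsCompletelyPositive Ψ) :
    IsCompletelyPositive (Φ ∘ₗ Ψ) := fun k M hM => by
  rw [ampliate_comp]
  exact hΦ k _ (hΨ k M hM)

lemma IsCompletelyPositive.ampliate [Fintype C] {Φ : Superop X Y}
    (h : IsCompletelyPositive Φ) : IsCompletelyPositive (ampliate C Φ) := fun k _ hM =>
  (h.ampliate_posSemidef (hM.submatrix (Equiv.prodAssoc X C (Fin k)).symm)).submatrix
    (Equiv.prodAssoc Y C (Fin k))

lemma isCompletelyPositive_relabel (e : X ≃ Y) : IsCompletelyPositive (relabel e) :=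
  fun _ _ hM => hM.submatrix (Prod.map e.symm id)

lemma ampliate_conjBy [Fintype X] [Fintype C] [DecidableEq C] (V : Matrix Y X ℂ) :
    ampliate C (conjBy V) = conjBy (V ⊗ₖ (1 : Matrix C C ℂ)) := by
  refine LinearMap.ext fun M => ?_
  ext ⟨y, c⟩ ⟨y', c'⟩
  simp [Matrix.mul_apply, Fintype.sum_prod_type, Matrix.one_apply, Finset.sum_mul,
    apply_ite (starRingEnd ℂ)]

lemma isCompletelyPositive_conjBy [Fintype X] [Fintype Y] (V : Matrix Y X ℂ) :
    IsCompletelyPositive (conjBy V) := fun k M hM => by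
  rw [ampliate_conjBy]
  exact hM.mul_mul_conjTranspose_same _

lemma IsCompletelyPositive.add {Φ Ψ : Superop X Y}
    (hΦ : IsCompletelyPositive Φ) (hΨ : IsCompletelyPositive Ψ) :
    IsCompletelyPositive (Φ + Ψ) := fun k M hM => (hΦ k M hM).add (hΨ k M hM)

lemma isCompletelyPositive_zero : IsCompletelyPositive (0 : Superop X Y) :=
  fun _ _ _ => Matrix.PosSemidef.zero

lemma isCompletelyPositive_sum {ι : Type*} (s : Finset ι) {Φ : ι → Superop X Y}
    (h : ∀ i ∈ s, IsCompletelyPositive (Φ i)) : IsCompletelyPositive (∑ i ∈ s, Φ i) :=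
  Finset.sum_induction _ _ (fun _ _ => IsCompletelyPositive.add) isCompletelyPositive_zero h

/-- Kraus representation of completely positive maps. -/
lemma IsCompletelyPositive.exists_kraus [Fintype X] [DecidableEq X] [Fintype Y]
    {Φ : Superop X Y} (h : IsCompletelyPositive Φ) :
    ∃ (k : ℕ) (K : Fin k → Matrix Y X ℂ), Φ = ∑ i, conjBy (K i) := by
  -- The unnormalized maximally entangled vector. Its image is the Choi matrix of `Φ`; the rows of a
  -- factor `B` of that matrix, conjugated and reshaped, are the Kraus operators.
  let ω : X × X → ℂ := fun p => if p.1 = p.2 then 1 else 0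
  obtain ⟨k, B, hB⟩ := exists_eq_conjTranspose_mul_self
    (h.ampliate_posSemidef (Matrix.posSemidef_vecMulVec_self_star ω))
  have hω : ∀ c c' : X, block c c' (Matrix.vecMulVec ω (star ω)) = Matrix.single c c' 1 := by
    intro c c'
    ext x x'
    simp only [block_apply, Matrix.vecMulVec_apply, Pi.star_apply, ω, Matrix.single_apply,
      eq_comm (a := c), eq_comm (a := c')]
    by_cases h1 : x = c <;> by_cases h2 : x' = c' <;> simp [h1, h2]
  refine ⟨k, fun i => Matrix.of fun y x => star (B i (y, x)), ?_⟩
  refine Matrix.ext_linearMap _ fun c c' => LinearMap.ext_ring ?_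
  ext y y'
  have := congrFun (congrFun hB (y, c)) (y', c')
  rw [ampliate_apply, hω] at this
  simp only [LinearMap.comp_apply, Matrix.singleLinearMap_apply]
  rw [this]
  simp [Matrix.sum_apply, Matrix.mul_apply, Matrix.single_apply, ite_and]

variable [Fintype X] [Fintype Y] [Fintype Z]

lemma trace_relabel (e : X ≃ Y) (M : Matrix X X ℂ) : (relabel e M).trace = M.trace := by
  simpa [Matrix.trace] using Equiv.sum_comp e.symm fun x => M x x

lemma trace_ampliate [Fintype C] {Φ : Superop X Y} (h : IsTracePreserving Φ)
    (M : Matrix (X × C) (X × C) ℂ) : (ampliate C Φ M).trace = M.trace := by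
  simp only [trace_eq_sum_block, block_ampliate, h _]

lemma IsChannel.comp {Φ : Superop Y Z} {Ψ : Superop X Y} (hΦ : IsChannel Φ) (hΨ : IsChannel Ψ) :
    IsChannel (Φ ∘ₗ Ψ) :=
  ⟨hΦ.1.comp hΨ.1, fun M => (hΦ.2 _).trans (hΨ.2 M)⟩

lemma IsChannel.ampliate [Fintype C] {Φ : Superop X Y} (h : IsChannel Φ) :
    IsChannel (ampliate C Φ) :=
  ⟨h.1.ampliate, trace_ampliate h.2⟩

lemma isChannel_relabel (e : X ≃ Y) : IsChannel (relabel e) :=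
  ⟨isCompletelyPositive_relabel e, trace_relabel e⟩

lemma isTracePreserving_sum_conjBy [DecidableEq X] {ι : Type*} [Fintype ι]
    {K : ι → Matrix Y X ℂ} (h : ∑ i, (K i)ᴴ * K i = 1) :
    IsTracePreserving (∑ i, conjBy (K i)) := fun M => by
  simp only [LinearMap.sum_apply, conjBy_apply, Matrix.trace_sum]
  simp_rw [Matrix.mul_assoc, Matrix.trace_mul_comm (K _), Matrix.mul_assoc]
  rw [← Matrix.trace_sum, ← Matrix.mul_sum, h, Matrix.mul_one]

lemma isChannel_sum_conjBy [DecidableEq X] {ι : Type*} [Fintype ι]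
    {K : ι → Matrix Y X ℂ} (h : ∑ i, (K i)ᴴ * K i = 1) : IsChannel (∑ i, conjBy (K i)) :=
  ⟨isCompletelyPositive_sum _ fun _ _ => isCompletelyPositive_conjBy _,
    isTracePreserving_sum_conjBy h⟩

lemma isChannel_conjBy [DecidableEq X] {V : Matrix Y X ℂ} (h : IsIsometry V) :
    IsChannel (conjBy V) := by
  simpa using isChannel_sum_conjBy (K := fun _ : Unit => V) (by simpa [IsIsometry] using h)

lemma IsChannel.isState {Φ : Superop X Y} (h : IsChannel Φ) {ρ : Matrix X X ℂ}
    (hρ : IsState ρ) : IsState (Φ ρ) :=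
  ⟨(h.1.ampliate_posSemidef (C := Unit) (hρ.1.submatrix Prod.fst)).submatrix fun y => (y, ()),
    (h.2 _).trans hρ.2⟩

lemma IsState.kronecker {ρ : Matrix X X ℂ} {σ : Matrix Y Y ℂ} (hρ : IsState ρ)
    (hσ : IsState σ) : IsState (ρ ⊗ₖ σ) :=
  ⟨hρ.1.kronecker hσ.1, by rw [Matrix.trace_kronecker, hρ.2, hσ.2, mul_one]⟩

/-- Attaching a state of an auxiliary system is a channel. -/
lemma isChannel_withSideState {R B : Type*} [Fintype R] [Fintype B] {E : Superop (R × B) B}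
    (hE : IsChannel E) {τ : Matrix R R ℂ} (hτ : IsState τ) : IsChannel (withSideState E τ) := by
  refine ⟨fun k M hM => ?_, fun M => ?_⟩
  · exact hE.1 k _
      ((hτ.1.kronecker hM).submatrix (Equiv.prodAssoc R B (Fin k)))
  · exact (hE.2 _).trans (by rw [Matrix.trace_kronecker, hτ.2, one_mul])

lemma isConditionallyUnitalPost_iff {R B : Type*} [Fintype R] [Fintype B] [DecidableEq B]
    {E : Superop (R × B) B} (hE : IsChannel E) :
    IsConditionallyUnitalPost E ↔ ∀ τ, IsState τ → E (τ ⊗ₖ unif B) = unif B :=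
  ⟨fun h τ hτ => (h τ hτ).2, fun h τ hτ => ⟨isChannel_withSideState hE hτ, h τ hτ⟩⟩

/-- The channel that performs the measurement `{T, 1 - T}` and prepares `σ₀` or `σ₁`. -/
noncomputable def measurePrepare [DecidableEq X] (T : Matrix X X ℂ) (σ₀ σ₁ : Matrix Y Y ℂ) :
    Superop X Y :=
  ((Matrix.traceLinearMap X ℂ ℂ ∘ₗ LinearMap.mulLeft ℂ T).smulRight σ₀) +
    ((Matrix.traceLinearMap X ℂ ℂ ∘ₗ LinearMap.mulLeft ℂ (1 - T)).smulRight σ₁)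

/-- With `T = Bᴴ * B`, the ampliated map sends `M` to `σ ⊗ G`, where `G` is a partial trace of `(B ⊗
1) M (B ⊗ 1)ᴴ` and hence positive. -/
lemma isCompletelyPositive_smulRight {T : Matrix X X ℂ} (hT : T.PosSemidef)
    {σ : Matrix Y Y ℂ} (hσ : σ.PosSemidef) :
    IsCompletelyPositive
      ((Matrix.traceLinearMap X ℂ ℂ ∘ₗ LinearMap.mulLeft ℂ T).smulRight σ) := fun k M hM => by
  obtain ⟨n, B, rfl⟩ := exists_eq_conjTranspose_mul_self hT
  let G : Matrix (Fin k) (Fin k) ℂ := ∑ i, (ampliate (Fin k) (conjBy B) M).submatrix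
    (fun c => (i, c)) (fun c => (i, c))
  have hG : G.PosSemidef := Matrix.posSemidef_sum _ fun i _ =>
    (isCompletelyPositive_conjBy B k M hM).submatrix _
  have key : ampliate (Fin k) ((Matrix.traceLinearMap X ℂ ℂ ∘ₗ
      LinearMap.mulLeft ℂ (Bᴴ * B)).smulRight σ) M = σ ⊗ₖ G := by
    ext ⟨y, c⟩ ⟨y', c'⟩
    have : (Bᴴ * B * block c c' M).trace = G c c' := by
      rw [Matrix.mul_assoc, Matrix.trace_mul_comm]
      simp [G, Matrix.trace, Matrix.sum_apply]
    simp [this, mul_comm]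
  rw [key]
  exact hσ.kronecker hG

lemma isChannel_measurePrepare [DecidableEq X] {T : Matrix X X ℂ} (hT : T.PosSemidef)
    (hT' : (1 - T).PosSemidef) {σ₀ σ₁ : Matrix Y Y ℂ} (h₀ : IsState σ₀) (h₁ : IsState σ₁) :
    IsChannel (measurePrepare T σ₀ σ₁) := by
  refine ⟨(isCompletelyPositive_smulRight hT h₀.1).add
    (isCompletelyPositive_smulRight hT' h₁.1), fun M => ?_⟩
  simp [measurePrepare, Matrix.trace_add, Matrix.trace_smul, h₀.2, h₁.2, Matrix.sub_mul,
    Matrix.trace_sub]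

-- Rescales a positive operator to a measurement effect. Since `T ≤ ‖T‖`, the constant `(‖T‖ + 1)⁻¹`
-- works; the added `1` covers `T = 0`.
open scoped MatrixOrder Matrix.Norms.L2Operator in
lemma exists_smul_one_sub_posSemidef [DecidableEq X] {T : Matrix X X ℂ} (hT : T.PosSemidef) :
    ∃ c : ℝ, 0 < c ∧ (1 - (c : ℂ) • T).PosSemidef := by
  have h1 := IsSelfAdjoint.le_algebraMap_norm_self (a := T) hT.1
  have h2 : ((algebraMap ℝ (Matrix X X ℂ) ‖T‖) - T).PosSemidef := Matrix.le_iff.mp h1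
  refine ⟨(‖T‖ + 1)⁻¹, by positivity, ?_⟩
  have h3 : (((‖T‖ + 1)⁻¹ : ℝ) • ((algebraMap ℝ (Matrix X X ℂ) ‖T‖) - T + 1)).PosSemidef :=
    (h2.add Matrix.PosSemidef.one).smul (by positivity)
  convert h3 using 1
  have hne : (‖T‖ + 1) ≠ 0 := by positivity
  rw [Algebra.algebraMap_eq_smul_one, smul_add, smul_sub, smul_smul, sub_add_eq_add_sub,
    ← add_smul, ← mul_add_one, inv_mul_cancel₀ hne, one_smul, Complex.coe_smul]

end Channels

/-! ### Supermaps with ancillary systems -/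

section SupermapStructure

variable {X Y X' Y' C D : Type*}

lemma superAmpliate_apply [Fintype C] [DecidableEq C] (Θ : Supermap X Y X' Y')
    (F : Superop (X × C) (Y × D)) (M : Matrix (X' × C) (X' × C) ℂ) (p q : Y' × D) :
    superAmpliate Θ F M p q =
      ∑ c, ∑ c', Θ (component F c c' p.2 q.2) (block c c' M) p.1 q.1 := rfl

lemma component_apply [DecidableEq C] (F : Superop (X × C) (Y × D)) (c c' : C) (d d' : D)
    (M : Matrix X X ℂ) (y y' : Y) :
    component F c c' d d' M y y' = F (M ⊗ₖ Matrix.single c c' (1 : ℂ)) (y, d) (y', d') := rfl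

lemma component_ampliate [DecidableEq C] (F : Superop X Y) (c c' d d' : C) :
    component (ampliate C F) c c' d d' = (Matrix.single c c' (1 : ℂ) d d') • F := by
  refine LinearMap.ext fun M => ?_
  ext y y'
  rw [component_apply, ampliate_apply, block_kronecker]
  simp

lemma superAmpliate_ampliate [Fintype C] [DecidableEq C] (Θ : Supermap X Y X' Y')
    (F : Superop X Y) : superAmpliate Θ (ampliate C F) = ampliate C (Θ F) := by
  refine LinearMap.ext fun M => ?_
  ext ⟨y, d⟩ ⟨y', d'⟩
  simp only [superAmpliate_apply, component_ampliate, map_smul, LinearMap.smul_apply,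
    Matrix.smul_apply]
  simp [Matrix.single_apply, ite_and]

/-- Superchannels are tested on ancillas `Fin k` and `Fin l`; this transports the test to arbitrary
finite `C` and `D`, in particular to those of the swap. -/
lemma superAmpliate_relabel {C₀ D₀ : Type*} [Fintype C] [DecidableEq C] [Fintype C₀]
    [DecidableEq C₀] (eC : C ≃ C₀) (eD : D ≃ D₀) (Θ : Supermap X Y X' Y')
    (F : Superop (X × C) (Y × D)) :
    superAmpliate Θ F = relabel (Equiv.prodCongr (Equiv.refl Y') eD.symm) ∘ₗ
      superAmpliate Θ (relabel (Equiv.prodCongr (Equiv.refl Y) eD) ∘ₗ F ∘ₗ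
        relabel (Equiv.prodCongr (Equiv.refl X) eC.symm)) ∘ₗ
      relabel (Equiv.prodCongr (Equiv.refl X') eC) := by
  refine LinearMap.ext fun M => ?_
  ext ⟨y, d⟩ ⟨y', d'⟩
  simp only [LinearMap.comp_apply, relabel_apply, superAmpliate_apply]
  refine Fintype.sum_equiv eC _ _ fun c => Fintype.sum_equiv eC _ _ fun c' => ?_
  have h1 : component F c c' d d' = component (relabel (Equiv.prodCongr (Equiv.refl Y) eD) ∘ₗ
      F ∘ₗ relabel (Equiv.prodCongr (Equiv.refl X) eC.symm)) (eC c) (eC c') (eD d) (eD d') := by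
    refine LinearMap.ext fun M => ?_
    ext y y'
    have : relabel (Equiv.prodCongr (Equiv.refl X) eC.symm)
        (M ⊗ₖ Matrix.single (eC c) (eC c') (1 : ℂ)) = M ⊗ₖ Matrix.single c c' (1 : ℂ) := by
      ext ⟨x, e⟩ ⟨x', e'⟩
      simp [Matrix.single_apply]
    simp [component_apply, this]
  have h2 : block c c' M =
      block (eC c) (eC c') (relabel (Equiv.prodCongr (Equiv.refl X') eC) M) := by
    ext x x'
    simp
  rw [h1, h2]
  rfl

lemma IsSuperchannel.isChannel_superAmpliate [Fintype X] [Fintype Y] [Fintype X'] [Fintype Y']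
    [Fintype C] [DecidableEq C] [Fintype D] {Θ : Supermap X Y X' Y'} (hΘ : IsSuperchannel Θ)
    {F : Superop (X × C) (Y × D)} (hF : IsChannel F) : IsChannel (superAmpliate Θ F) := by
  rw [superAmpliate_relabel (Fintype.equivFin C) (Fintype.equivFin D)]
  exact (isChannel_relabel _).comp ((hΘ _ _ _
    ((isChannel_relabel _).comp (hF.comp (isChannel_relabel _)))).comp (isChannel_relabel _))

lemma IsSuperchannel.isTracePreserving [Fintype X] [Fintype Y] [Fintype X'] [Fintype Y']
    {Θ : Supermap X Y X' Y'} (hΘ : IsSuperchannel Θ) {F : Superop X Y} (hF : IsChannel F) :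
    IsTracePreserving (Θ F) := fun M => by
  have h := (hΘ.isChannel_superAmpliate (hF.ampliate (C := Unit))).2
    (M.submatrix Prod.fst Prod.fst)
  rw [superAmpliate_ampliate, trace_eq_sum_block, trace_eq_sum_block] at h
  have hM : block () () (M.submatrix Prod.fst Prod.fst) = M := rfl
  simpa [block_ampliate, hM] using h

end SupermapStructure

/-! ### Supermaps given by pre- and post-processing, and the bipartite map of a supermap -/

section PrePost

variable {R A' A B C D : Type*}

/-- The supermap `F ↦ E ∘ (id ⊗ F) ∘ V`. -/
def prePostSupermap [Fintype A'] (V : Matrix (R × A) A' ℂ) (E : Superop (R × B) B) :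
    Supermap A B A' B where
  toFun := prePost V E
  map_add' F G := by
    have : ampliate R (F + G) = ampliate R F + ampliate R G := rfl
    simp only [prePost, this, LinearMap.comp_add, LinearMap.add_comp]
  map_smul' a F := by
    have : ampliate R (a • F) = a • ampliate R F := rfl
    simp only [prePost, this, LinearMap.comp_smul, LinearMap.smul_comp, RingHom.id_apply]

/-- `V` and `E` do not touch the ancillas, so `C` and `D` pass through alongside. For a channel `F`
the right side is a composite of channels; for the swap it is `semilocal V E`. -/
lemma superAmpliate_prePostSupermap [Fintype A'] [Fintype C] [DecidableEq C]
    (V : Matrix (R × A) A' ℂ) (E : Superop (R × B) B) (F : Superop (A × C) (B × D)) :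
    superAmpliate (prePostSupermap V E) F =
      ampliate D E ∘ₗ relabel ((Equiv.prodComm (B × D) R).trans (Equiv.prodAssoc R B D).symm) ∘ₗ
        ampliate R F ∘ₗ relabel ((Equiv.prodAssoc R A C).trans (Equiv.prodComm R (A × C))) ∘ₗ
        ampliate C (conjBy V) := by
  refine LinearMap.ext fun M => ?_
  ext ⟨b, d⟩ ⟨b', d'⟩
  -- The operator handed to `E`, assembled from the components of `F`. It is a block of the full
  -- operator because each block of the input expands in matrix units of `C`.
  let G : Matrix (R × B) (R × B) ℂ := ∑ c, ∑ c',
    relabel (Equiv.prodComm B R) (ampliate R (component F c c' d d')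
      (relabel (Equiv.prodComm R A) (conjBy V (block c c' M))))
  let e₁ := (Equiv.prodAssoc R A C).trans (Equiv.prodComm R (A × C))
  let e₂ := (Equiv.prodComm (B × D) R).trans (Equiv.prodAssoc R B D).symm
  have hG : G = block d d' (relabel e₂ (ampliate R F (relabel e₁ (ampliate C (conjBy V) M)))) := by
    ext ⟨r, x⟩ ⟨r', x'⟩
    rw [block_apply, relabel_apply, ampliate_apply]
    conv_rhs => rw [eq_sum_block_kronecker (block _ _ _)]
    simp only [G, Matrix.sum_apply, map_sum]
    rfl
  have hE : superAmpliate (prePostSupermap V E) F M (b, d) (b', d') = E G b b' := by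
    simp only [G, map_sum, Matrix.sum_apply]
    rfl
  rw [hE, hG]
  rfl

/-- The bipartite map associated with a supermap, obtained by applying it to the swap. -/
def toBipartite [Fintype B] [DecidableEq B] (Θ : Supermap A B A' B) :
    Superop (A' × B) (A × B) :=
  relabel (Equiv.prodComm B A) ∘ₗ superAmpliate Θ (relabel (Equiv.prodComm A B))

lemma toBipartite_prePostSupermap [Fintype A'] [Fintype B] [DecidableEq B]
    (V : Matrix (R × A) A' ℂ) (E : Superop (R × B) B) :
    toBipartite (prePostSupermap V E) = semilocal V E := by
  rw [toBipartite, superAmpliate_prePostSupermap]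
  rfl

/-- The map `M ↦ M a a' • σ`. -/
def entryPrepare (a a' : A) (σ : Matrix B B ℂ) : Superop A B :=
  (Matrix.entryLinearMap ℂ ℂ a a').smulRight σ

lemma entryPrepare_apply (a a' : A) (σ : Matrix B B ℂ) (M : Matrix A A ℂ) :
    entryPrepare a a' σ M = M a a' • σ := rfl

lemma component_swap [DecidableEq B] (b b' : B) (a a' : A) :
    component (relabel (Equiv.prodComm A B)) b b' a a' =
      entryPrepare a a' (Matrix.single b b' (1 : ℂ)) := rfl

lemma eq_sum_entryPrepare [Fintype A] [DecidableEq A] (F : Superop A B) :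
    F = ∑ a, ∑ a', entryPrepare a a' (F (Matrix.single a a' 1)) := by
  refine LinearMap.ext fun M => ?_
  conv_lhs => rw [Matrix.matrix_eq_sum_single M]
  simp only [map_sum, LinearMap.sum_apply, entryPrepare_apply]
  refine Finset.sum_congr rfl fun a _ => Finset.sum_congr rfl fun a' _ => ?_
  rw [← map_smul, Matrix.smul_single, smul_eq_mul, mul_one]

/-- The dictionary between a supermap and its bipartite map, used both to recover `Θ` and to express
partial traces of `toBipartite Θ` through traces of values of `Θ`. -/
lemma toBipartite_kronecker [Fintype B] [DecidableEq B] (Θ : Supermap A B A' B)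
    (ρ : Matrix A' A' ℂ) (σ : Matrix B B ℂ) (a a' : A) (b b' : B) :
    toBipartite Θ (ρ ⊗ₖ σ) (a, b) (a', b') = Θ (entryPrepare a a' σ) ρ b b' := by
  have h : entryPrepare a a' σ =
      ∑ c, ∑ c', σ c c' • entryPrepare a a' (Matrix.single c c' (1 : ℂ)) := by
    refine LinearMap.ext fun M => ?_
    conv_lhs => rw [entryPrepare_apply, Matrix.matrix_eq_sum_single σ]
    simp only [LinearMap.sum_apply, LinearMap.smul_apply, entryPrepare_apply, Finset.smul_sum,
      Matrix.smul_single, smul_eq_mul, mul_one, mul_comm]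
  rw [h]
  simp [toBipartite, superAmpliate_apply, component_swap, block_kronecker, Matrix.sum_apply]

/-- The maps `entryPrepare a a' σ` span all maps `A → B`, and `Θ` on them consists of entries of
`toBipartite Θ`. -/
lemma toBipartite_injective [Fintype A] [Fintype B] [DecidableEq A] [DecidableEq B] :
    Function.Injective (toBipartite : Supermap A B A' B → Superop (A' × B) (A × B)) := by
  intro Θ Θ' h
  refine LinearMap.ext fun F => LinearMap.ext fun ρ => ?_
  ext b b'
  rw [eq_sum_entryPrepare F]
  simp only [map_sum, LinearMap.sum_apply, Matrix.sum_apply, ← toBipartite_kronecker, h]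

lemma IsSuperchannel.isChannel_toBipartite [Fintype A'] [Fintype A] [Fintype B] [DecidableEq B]
    {Θ : Supermap A B A' B} (hΘ : IsSuperchannel Θ) : IsChannel (toBipartite Θ) :=
  (isChannel_relabel _).comp (hΘ.isChannel_superAmpliate (isChannel_relabel _))

variable [Fintype R] [Fintype A'] [DecidableEq A'] [Fintype A] [Fintype B]

lemma isChannel_semilocal {V : Matrix (R × A) A' ℂ} {E : Superop (R × B) B}
    (hV : IsIsometry V) (hE : IsChannel E) : IsChannel (semilocal V E) :=
  (isChannel_relabel _).comp (hE.ampliate.comp ((isChannel_relabel _).comp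
    (isChannel_conjBy hV).ampliate))

lemma isSuperchannel_prePostSupermap {V : Matrix (R × A) A' ℂ} {E : Superop (R × B) B}
    (hV : IsIsometry V) (hE : IsChannel E) : IsSuperchannel (prePostSupermap V E) := by
  intro k l F hF
  rw [superAmpliate_prePostSupermap]
  exact hE.ampliate.comp ((isChannel_relabel _).comp (hF.ampliate.comp
    ((isChannel_relabel _).comp (isChannel_conjBy hV).ampliate)))

lemma isRealization_iff {Θ : Supermap A B A' B} {V : Matrix (R × A) A' ℂ}
    {E : Superop (R × B) B} :
    IsRealization Θ V E ↔ IsIsometry V ∧ IsChannel E ∧ Θ = prePostSupermap V E :=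
  and_congr_right fun _ => and_congr_right fun _ =>
    (LinearMap.ext_iff (f := Θ) (g := prePostSupermap V E)).symm

lemma IsRealization.isSuperchannel {Θ : Supermap A B A' B} {V : Matrix (R × A) A' ℂ}
    {E : Superop (R × B) B} (h : IsRealization Θ V E) : IsSuperchannel Θ := by
  obtain ⟨hV, hE, rfl⟩ := isRealization_iff.mp h
  exact isSuperchannel_prePostSupermap hV hE

lemma IsRealization.toBipartite_eq [DecidableEq B] {Θ : Supermap A B A' B}
    {V : Matrix (R × A) A' ℂ} {E : Superop (R × B) B} (h : IsRealization Θ V E) :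
    toBipartite Θ = semilocal V E := by
  obtain ⟨_, _, rfl⟩ := isRealization_iff.mp h
  exact toBipartite_prePostSupermap V E

end PrePost

/-! ### Non-signalling maps -/

section NonSignalling

variable {R A' A B : Type*}

/-- The partial trace as a linear map. -/
def traceSndLinearMap (X Y : Type*) [Fintype Y] :
    Matrix (X × Y) (X × Y) ℂ →ₗ[ℂ] Matrix X X ℂ := ∑ y, block y y

lemma traceSndLinearMap_apply {X Y : Type*} [Fintype Y] (M : Matrix (X × Y) (X × Y) ℂ) :
    traceSndLinearMap X Y M = traceSnd M := by
  rw [traceSnd_eq_sum_block, traceSndLinearMap, LinearMap.sum_apply]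

variable [Fintype A'] [Fintype B]

/-- States span, so by linearity in each factor the reduced output on `ρ ⊗ τ` is `τ.trace` times
that on `ρ ⊗ σ`, for all operators. Expanding `M` in matrix units of `B`, only the diagonal blocks
have nonzero trace, and they add up to `traceSnd M`. -/
lemma traceSnd_eq_of_product [DecidableEq A'] [DecidableEq B] {N : Superop (A' × B) (A × B)}
    (h : ∀ ρ σ₀ σ₁, IsState ρ → IsState σ₀ → IsState σ₁ →
      traceSnd (N (ρ ⊗ₖ σ₀)) = traceSnd (N (ρ ⊗ₖ σ₁)))
    {σ : Matrix B B ℂ} (hσ : IsState σ) (M : Matrix (A' × B) (A' × B) ℂ) :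
    traceSnd (N M) = traceSnd (N (traceSnd M ⊗ₖ σ)) := by
  let T := traceSndLinearMap A B ∘ₗ N
  let κ : Matrix A' A' ℂ →ₗ[ℂ] Matrix B B ℂ →ₗ[ℂ] Matrix (A' × B) (A' × B) ℂ :=
    Matrix.kroneckerBilinear
  have hT : ∀ M, T M = traceSnd (N M) := fun M => traceSndLinearMap_apply _
  have h1 : ∀ ρ, IsState ρ → ∀ τ, T (ρ ⊗ₖ τ) = τ.trace • T (ρ ⊗ₖ σ) := by
    intro ρ hρ
    have : T ∘ₗ κ ρ = (Matrix.traceLinearMap B ℂ ℂ).smulRight (T (ρ ⊗ₖ σ)) := by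
      refine linearMap_ext_isState fun τ hτ => ?_
      have : T (ρ ⊗ₖ τ) = T (ρ ⊗ₖ σ) := by rw [hT, hT, h ρ τ σ hρ hτ hσ]
      change T (ρ ⊗ₖ τ) = τ.trace • T (ρ ⊗ₖ σ)
      rw [this, hτ.2, one_smul]
    exact fun τ => LinearMap.congr_fun this τ
  have h2 : ∀ τ ρ, T (ρ ⊗ₖ τ) = τ.trace • T (ρ ⊗ₖ σ) := by
    intro τ
    have : T ∘ₗ κ.flip τ = τ.trace • (T ∘ₗ κ.flip σ) :=
      linearMap_ext_isState fun ρ hρ => h1 ρ hρ τ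
    exact fun ρ => LinearMap.congr_fun this ρ
  rw [← hT, ← hT]
  conv_lhs => rw [eq_sum_block_kronecker M]
  have h3 : traceSnd M ⊗ₖ σ = ∑ b, block b b M ⊗ₖ σ := by
    rw [traceSnd_eq_sum_block]
    exact map_sum (κ.flip σ) _ _
  rw [h3, map_sum, map_sum]
  refine Finset.sum_congr rfl fun b _ => ?_
  simp only [map_sum, h2 (Matrix.single _ _ _)]
  rw [Finset.sum_eq_single b]
  · simp
  · intro b' _ hb
    simp [Matrix.trace_single_eq_of_ne _ _ _ hb.symm]
  · simp

/-- It suffices to test non-signalling on product states. -/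
lemma isNonSignalling_of_product [DecidableEq A'] [DecidableEq B] [Nonempty B]
    {N : Superop (A' × B) (A × B)}
    (h : ∀ ρ σ₀ σ₁, IsState ρ → IsState σ₀ → IsState σ₁ →
      traceSnd (N (ρ ⊗ₖ σ₀)) = traceSnd (N (ρ ⊗ₖ σ₁))) : IsNonSignalling N := by
  intro ρ₁ ρ₂ _ _ hρ
  rw [traceSnd_eq_of_product h isState_unif ρ₁, traceSnd_eq_of_product h isState_unif ρ₂, hρ]

lemma IsNonSignalling.traceSnd_eq [DecidableEq A'] [DecidableEq B]
    {N : Superop (A' × B) (A × B)} (h : IsNonSignalling N)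
    {σ : Matrix B B ℂ} (hσ : IsState σ) (M : Matrix (A' × B) (A' × B) ℂ) :
    traceSnd (N M) = traceSnd (N (traceSnd M ⊗ₖ σ)) := by
  refine traceSnd_eq_of_product (fun ρ σ₀ σ₁ hρ h₀ h₁ => ?_) hσ M
  refine h _ _ (hρ.kronecker h₀) (hρ.kronecker h₁) ?_
  rw [traceSnd_kronecker, traceSnd_kronecker, h₀.2, h₁.2]

/-- `E` preserves the trace, so discarding its output amounts to discarding its input `RB`. -/
lemma traceSnd_semilocal [Fintype R] (V : Matrix (R × A) A' ℂ) {E : Superop (R × B) B}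
    (hE : IsChannel E) (M : Matrix (A' × B) (A' × B) ℂ) :
    traceSnd (semilocal V E M) =
      traceSnd (relabel (Equiv.prodComm R A) (conjBy V (traceSnd M))) := by
  ext a a'
  have h : traceSnd (semilocal V E M) a a' =
    (E (block a a' (relabel (shuffle R A B) (ampliate B (conjBy V) M)))).trace := rfl
  rw [h, hE.2, traceSnd_eq_sum_block M, map_sum, map_sum]
  simp [Matrix.trace, Fintype.sum_prod_type, Matrix.sum_apply, shuffle]

lemma isNonSignalling_semilocal [Fintype R] (V : Matrix (R × A) A' ℂ) {E : Superop (R × B) B}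
    (hE : IsChannel E) : IsNonSignalling (semilocal V E) := by
  intro ρ₁ ρ₂ _ _ h
  rw [traceSnd_semilocal V hE, traceSnd_semilocal V hE, h]

/-- Let `F` measure `{T, 1 - T}` and prepare `σ` or `σ₁`. The trace of `Θ F ρ` is that of `ρ`, and
the contribution of `1 - T` does not involve `σ`. So the pairing of `T` with the reduced output on
`ρ ⊗ σ` does not depend on `σ`. Rescaled effects exhaust the positive operators, which span. -/
lemma IsSuperchannel.isNonSignalling_toBipartite [DecidableEq A'] [Fintype A] [DecidableEq A]
    [DecidableEq B] [Nonempty B] {Θ : Supermap A B A' B} (hΘ : IsSuperchannel Θ) :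
    IsNonSignalling (toBipartite Θ) := by
  refine isNonSignalling_of_product fun ρ σ₀ σ₁ _ h₀ h₁ => ?_
  have htr : ∀ (σ : Matrix B B ℂ) (a a' : A),
      traceSnd (toBipartite Θ (ρ ⊗ₖ σ)) a a' = (Θ (entryPrepare a a' σ) ρ).trace := by
    intro σ a a'
    simp [Matrix.trace, toBipartite_kronecker]
  have hmp : ∀ (T : Matrix A A ℂ) (σ : Matrix B B ℂ), (Θ (measurePrepare T σ σ₁) ρ).trace =
      (T * traceSnd (toBipartite Θ (ρ ⊗ₖ σ))).trace +
        (Θ ((Matrix.traceLinearMap A ℂ ℂ ∘ₗ LinearMap.mulLeft ℂ (1 - T)).smulRight σ₁)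
          ρ).trace := by
    intro T σ
    have : (Matrix.traceLinearMap A ℂ ℂ ∘ₗ LinearMap.mulLeft ℂ T).smulRight σ =
        ∑ a, ∑ a', T a a' • entryPrepare a' a σ := by
      refine LinearMap.ext fun M => ?_
      simp [Matrix.trace, Matrix.mul_apply, entryPrepare_apply, Finset.sum_smul, smul_smul]
    rw [measurePrepare, this]
    simp only [map_add, map_sum, map_smul, LinearMap.add_apply, LinearMap.sum_apply,
      LinearMap.smul_apply, Matrix.trace_add, Matrix.trace_sum, Matrix.trace_smul, smul_eq_mul,
      ← htr]
    simp [Matrix.trace, Matrix.mul_apply]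
  have heff : ∀ T : Matrix A A ℂ, T.PosSemidef → (1 - T).PosSemidef →
      (T * traceSnd (toBipartite Θ (ρ ⊗ₖ σ₀))).trace =
        (T * traceSnd (toBipartite Θ (ρ ⊗ₖ σ₁))).trace := by
    intro T hT hT'
    have e₀ := hΘ.isTracePreserving (isChannel_measurePrepare hT hT' h₀ h₁) ρ
    have e₁ := hΘ.isTracePreserving (isChannel_measurePrepare hT hT' h₁ h₁) ρ
    rw [hmp] at e₀ e₁
    exact add_right_cancel (e₀.trans e₁.symm)
  have hlin : Matrix.traceLinearMap A ℂ ℂ ∘ₗ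
      LinearMap.mulRight ℂ (traceSnd (toBipartite Θ (ρ ⊗ₖ σ₀))) =
      Matrix.traceLinearMap A ℂ ℂ ∘ₗ
      LinearMap.mulRight ℂ (traceSnd (toBipartite Θ (ρ ⊗ₖ σ₁))) := by
    refine linearMap_ext_posSemidef fun T hT => ?_
    obtain ⟨c, hc, hcT⟩ := exists_smul_one_sub_posSemidef hT
    have := heff ((c : ℂ) • T) (hT.smul (by exact_mod_cast hc.le)) hcT
    rw [Matrix.smul_mul, Matrix.smul_mul, Matrix.trace_smul, Matrix.trace_smul] at this
    exact smul_right_injective ℂ (by exact_mod_cast hc.ne' : (c : ℂ) ≠ 0) this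
  exact Matrix.ext_iff_trace_mul_left.mpr fun T => LinearMap.congr_fun hlin T

end NonSignalling

/-! ### Dilation of non-signalling channels -/

section Dilation

variable {R S A' A B : Type*}

/-- The operator `⟨a|V` from `A'` to `R`. -/
def outputSlice (V : Matrix (R × A) A' ℂ) (a : A) : Matrix R A' ℂ := V.submatrix (fun r => (r, a)) id

/-- The operator `V` from `A'` to `RA`, as a matrix with rows labelled by `R` only. -/
def auxiliaryRows (V : Matrix (R × A) A' ℂ) : Matrix R (A × A') ℂ :=
  Matrix.of fun r p => V (r, p.1) p.2

/-- Inverse of `auxiliaryRows`. -/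
def ofAuxiliaryRows (L : Matrix R (A × A') ℂ) : Matrix (R × A) A' ℂ :=
  Matrix.of fun p x => L p.1 (p.2, x)

lemma mul_mul_conjTranspose_apply {m n : Type*} [Fintype n] (P Q : Matrix m n ℂ)
    (M : Matrix n n ℂ) (i j : m) : (P * M * Qᴴ) i j = P i ⬝ᵥ (M *ᵥ star (Q j)) := by
  rw [Matrix.mul_assoc]
  rfl

lemma semilocal_apply [Fintype A'] [Fintype B] [DecidableEq B] (V : Matrix (R × A) A' ℂ)
    (E : Superop (R × B) B) (M : Matrix (A' × B) (A' × B) ℂ) (a a' : A) (b b' : B) :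
    semilocal V E M (a, b) (a', b') =
      E ((outputSlice V a ⊗ₖ (1 : Matrix B B ℂ)) * M *
        (outputSlice V a' ⊗ₖ (1 : Matrix B B ℂ))ᴴ) b b' := by
  have h : semilocal V E M (a, b) (a', b') =
    E (block a a' (relabel (shuffle R A B) (ampliate B (conjBy V) M))) b b' := rfl
  rw [h, ampliate_conjBy]
  rfl

/-- An operator on the auxiliary system may be moved from `V` into `E`; this is how that system is
shrunk. -/
lemma semilocal_eq_of_outputSlice [Fintype R] [Fintype S] [Fintype A'] [Fintype B]
    [DecidableEq B] {V : Matrix (R × A) A' ℂ} {V' : Matrix (S × A) A' ℂ} {Q : Matrix R S ℂ}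
    (h : ∀ a, Q * outputSlice V' a = outputSlice V a) (E : Superop (R × B) B) :
    semilocal V' (E ∘ₗ conjBy (Q ⊗ₖ (1 : Matrix B B ℂ))) = semilocal V E := by
  have hk : ∀ a, (Q ⊗ₖ (1 : Matrix B B ℂ)) * (outputSlice V' a ⊗ₖ (1 : Matrix B B ℂ)) =
      outputSlice V a ⊗ₖ (1 : Matrix B B ℂ) := fun a => by
    rw [← Matrix.mul_kronecker_mul, h, Matrix.one_mul]
  refine LinearMap.ext fun M => ?_
  ext ⟨a, b⟩ ⟨a', b'⟩
  rw [semilocal_apply, semilocal_apply, LinearMap.comp_apply, conjBy_apply, ← hk, ← hk,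
    Matrix.conjTranspose_mul (Q ⊗ₖ (1 : Matrix B B ℂ))]
  simp only [Matrix.mul_assoc]

/-- Whether the reshaped matrix is an isometry depends only on the Gram matrix of `L`. -/
lemma conjTranspose_mul_self_apply_of_rows [Fintype R] [Fintype A] (L : Matrix R (A × A') ℂ)
    (x x' : A') :
    ((ofAuxiliaryRows L)ᴴ * ofAuxiliaryRows L) x x' = ∑ a, (Lᴴ * L) (a, x) (a, x') := by
  simp only [Matrix.mul_apply, Fintype.sum_prod_type, ofAuxiliaryRows, Matrix.of_apply,
    Matrix.conjTranspose_apply]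
  exact Finset.sum_comm

/-- Non-signalling channels are semilocal. -/
lemma IsNonSignalling.exists_semilocal [Fintype A'] [DecidableEq A'] [Fintype A] [DecidableEq A]
    [Fintype B] [DecidableEq B] [Nonempty B] {N : Superop (A' × B) (A × B)}
    (hns : IsNonSignalling N) (hN : IsChannel N) :
    ∃ (r : ℕ) (V : Matrix (Fin r × A) A' ℂ) (E : Superop (Fin r × B) B),
      IsIsometry V ∧ IsChannel E ∧ N = semilocal V E := by
  obtain ⟨k, K, hK⟩ := hN.1.exists_kraus
  let b₀ : B := Classical.arbitrary B
  let KK : Matrix (Fin k × B) (A × (A' × B)) ℂ := Matrix.of fun p q => K p.1 (q.1, p.2) q.2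
  -- The rows of `KK` run over the Kraus index and the output on `B`, so its Gram matrix sums over
  -- both and yields the reduced output of `N`.
  have hKK : ∀ a a' x x', (KKᴴ * KK) (a, x) (a', x') =
      traceSnd (N (Matrix.single x' x 1)) a' a := by
    intro a a' x x'
    rw [hK]
    simp only [Matrix.mul_apply, Fintype.sum_prod_type, KK, Matrix.of_apply,
      Matrix.conjTranspose_apply, traceSnd_apply, LinearMap.sum_apply, Matrix.sum_apply,
      conjBy_apply, Matrix.single_apply]
    rw [Finset.sum_comm]
    refine Finset.sum_congr rfl fun b _ => Finset.sum_congr rfl fun i _ => ?_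
    obtain ⟨x, c⟩ := x
    obtain ⟨x', c'⟩ := x'
    simp [ite_and, mul_comm]
  -- Non-signalling: the reduced output sees the input on `B` only through the trace of the matrix
  -- unit, so `b₀` can stand for every diagonal input.
  have hred : ∀ x x' b b', traceSnd (N (Matrix.single (x', b') (x, b) 1)) =
      if b = b' then traceSnd (N (Matrix.single (x', b₀) (x, b₀) 1)) else 0 := by
    intro x x' b b'
    have hs : ∀ c' c : B, Matrix.single (x', c') (x, c) (1 : ℂ) =
        Matrix.single x' x (1 : ℂ) ⊗ₖ Matrix.single c' c (1 : ℂ) := fun c' c => by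
      rw [Matrix.single_kronecker_single, mul_one]
    rw [hns.traceSnd_eq (isState_single b₀), hs b' b, hs b₀ b₀, traceSnd_kronecker]
    split_ifs with hb
    · subst hb
      simp
    · rw [Matrix.trace_single_eq_of_ne _ _ _ (Ne.symm hb), zero_smul, Matrix.zero_kronecker,
        map_zero]
      ext
      simp
  -- The columns of `KK` with input `b₀` have Gram matrix `G`. Compressing to their span gives `L`
  -- with the same Gram matrix and a right inverse `P`.
  let B₀ : Matrix (Fin k × B) (A × A') ℂ := KK.submatrix id fun p => (p.1, (p.2, b₀))
  obtain ⟨r, Q, P, -, hQB, hP⟩ := exists_isometry_onto_range B₀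
  let L : Matrix (Fin r) (A × A') ℂ := Qᴴ * B₀
  have hLL : ∀ a a' x x', (Lᴴ * L) (a, x) (a', x') =
      traceSnd (N (Matrix.single (x', b₀) (x, b₀) 1)) a' a := by
    intro a a' x x'
    have : Lᴴ * L = B₀ᴴ * B₀ := by
      rw [Matrix.conjTranspose_mul, Matrix.conjTranspose_conjTranspose, Matrix.mul_assoc,
        ← Matrix.mul_assoc Q, hQB]
    rw [this, ← hKK]
    rfl
  let e := (Equiv.prodAssoc A A' B).symm
  let LL : Matrix (Fin r × B) (A × (A' × B)) ℂ := (L ⊗ₖ (1 : Matrix B B ℂ)).submatrix id e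
  have hLP : LL * (P ⊗ₖ (1 : Matrix B B ℂ)).submatrix e id = 1 := by
    rw [Matrix.submatrix_mul_equiv, ← Matrix.mul_kronecker_mul, hP, Matrix.one_mul,
      Matrix.one_kronecker_one, Matrix.submatrix_id_id]
  have hgram : KKᴴ * KK = LLᴴ * LL := by
    have h1 : LLᴴ * LL = ((Lᴴ * L) ⊗ₖ (1 : Matrix B B ℂ)).submatrix e e := by
      rw [Matrix.conjTranspose_submatrix, ← Matrix.submatrix_mul _ _ e id e Function.bijective_id,
        Matrix.conjTranspose_kronecker, ← Matrix.mul_kronecker_mul, Matrix.conjTranspose_one,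
        Matrix.one_mul]
    ext ⟨a, x, b⟩ ⟨a', x', b'⟩
    rw [hKK, hred, h1]
    simp only [e, Matrix.submatrix_apply, Equiv.prodAssoc_symm_apply, Matrix.kroneckerMap_apply,
      hLL, Matrix.one_apply]
    split_ifs <;> simp
  obtain ⟨W, hW, hWL⟩ := exists_isometry_of_gram_eq hLP hgram
  -- Slicing the isometry `W` along the Kraus index of `N` gives the Kraus operators of `E`, with as
  -- many terms as `N` has.
  let F : Fin k → Matrix B (Fin r × B) ℂ := fun i => W.submatrix (fun b => (i, b)) id
  have hF : ∑ i, (F i)ᴴ * F i = 1 := by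
    rw [← hW]
    ext p q
    simp [Matrix.sum_apply, Matrix.mul_apply, Fintype.sum_prod_type, F]
  refine ⟨r, ofAuxiliaryRows L, ∑ i, conjBy (F i), ?_, isChannel_sum_conjBy hF, ?_⟩
  · ext x x'
    rw [conjTranspose_mul_self_apply_of_rows]
    simp only [hLL]
    have : (traceSnd (N (Matrix.single (x', b₀) (x, b₀) 1))).trace =
        (1 : Matrix A' A' ℂ) x x' := by
      rw [trace_traceSnd, hN.2]
      by_cases hx : x = x'
      · subst hx
        simp
      · rw [Matrix.one_apply_ne hx, Matrix.trace_single_eq_of_ne]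
        simpa using Ne.symm hx
    exact this
  · have hrow : ∀ i a b x, (F i * (outputSlice (ofAuxiliaryRows L) a ⊗ₖ (1 : Matrix B B ℂ))) b x =
        K i (a, b) x := by
      intro i a b x
      have : K i (a, b) x = (W * LL) (i, b) (a, x) := by rw [hWL]; rfl
      rw [this]
      rfl
    rw [hK]
    refine LinearMap.ext fun M => ?_
    ext ⟨a, b⟩ ⟨a', b'⟩
    rw [semilocal_apply]
    simp only [LinearMap.sum_apply, Matrix.sum_apply, conjBy_apply]
    refine Finset.sum_congr rfl fun i _ => ?_
    have : F i * ((outputSlice (ofAuxiliaryRows L) a ⊗ₖ (1 : Matrix B B ℂ)) * M *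
        (outputSlice (ofAuxiliaryRows L) a' ⊗ₖ (1 : Matrix B B ℂ))ᴴ) * (F i)ᴴ =
        (F i * (outputSlice (ofAuxiliaryRows L) a ⊗ₖ (1 : Matrix B B ℂ))) * M *
        (F i * (outputSlice (ofAuxiliaryRows L) a' ⊗ₖ (1 : Matrix B B ℂ)))ᴴ := by
      rw [Matrix.conjTranspose_mul (F i)]
      simp only [Matrix.mul_assoc]
    rw [this, mul_mul_conjTranspose_apply, mul_mul_conjTranspose_apply,
      funext (hrow i a b), funext (hrow i a' b')]

end Dilation

/-! ### Realizations and standard forms -/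

section StandardForm

variable {R A' A B : Type*} [Fintype A'] [DecidableEq A'] [Fintype A] [DecidableEq A]
  [Fintype B] [DecidableEq B]

lemma IsSuperchannel.exists_realization [Nonempty B] {Θ : Supermap A B A' B}
    (hΘ : IsSuperchannel Θ) :
    ∃ (r : ℕ) (V : Matrix (Fin r × A) A' ℂ) (E : Superop (Fin r × B) B), IsRealization Θ V E := by
  obtain ⟨r, V, E, hV, hE, h⟩ :=
    hΘ.isNonSignalling_toBipartite.exists_semilocal hΘ.isChannel_toBipartite
  rw [← toBipartite_prePostSupermap] at h
  exact ⟨r, V, E, isRealization_iff.mpr ⟨hV, hE, toBipartite_injective h⟩⟩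

lemma IsSuperchannel.exists_standardForm [Nonempty B] {Θ : Supermap A B A' B}
    (hΘ : IsSuperchannel Θ) :
    ∃ (r : ℕ) (V : Matrix (Fin r × A) A' ℂ) (E : Superop (Fin r × B) B),
      IsStandardForm Θ r V E := by
  classical
  have h := hΘ.exists_realization
  obtain ⟨V, E, hVE⟩ := Nat.find_spec h
  exact ⟨Nat.find h, V, E, hVE, fun r' V' E' h' => Nat.find_min' h ⟨V', E', h'⟩⟩

/-- In a standard form the operators `⟨a|V|x⟩` span the auxiliary system. -/
lemma IsStandardForm.exists_rightInverse {Θ : Supermap A B A' B} {r : ℕ}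
    {V : Matrix (Fin r × A) A' ℂ} {E : Superop (Fin r × B) B} (h : IsStandardForm Θ r V E) :
    ∃ P : Matrix (A × A') (Fin r) ℂ, auxiliaryRows V * P = 1 := by
  obtain ⟨r', Q, P, hQ, hQB, hP⟩ := exists_isometry_onto_range (auxiliaryRows V)
  obtain ⟨hV, hE, -⟩ := h.1
  have hsl : ∀ a, Q * outputSlice (ofAuxiliaryRows (Qᴴ * auxiliaryRows V)) a =
      outputSlice V a := by
    intro a
    ext j x
    have := congrFun (congrFun hQB j) (a, x)
    rw [Matrix.mul_assoc] at this
    exact this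
  have hV' : IsIsometry (ofAuxiliaryRows (Qᴴ * auxiliaryRows V)) := by
    rw [IsIsometry, ← show Vᴴ * V = 1 from hV]
    ext x x'
    have : (Qᴴ * auxiliaryRows V)ᴴ * (Qᴴ * auxiliaryRows V) =
        (auxiliaryRows V)ᴴ * auxiliaryRows V := by
      rw [Matrix.conjTranspose_mul, Matrix.conjTranspose_conjTranspose, Matrix.mul_assoc,
        ← Matrix.mul_assoc Q, hQB]
    rw [conjTranspose_mul_self_apply_of_rows, this, ← conjTranspose_mul_self_apply_of_rows]
    rfl
  have hQ1 : IsIsometry (Q ⊗ₖ (1 : Matrix B B ℂ)) := by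
    rw [IsIsometry, Matrix.conjTranspose_kronecker, ← Matrix.mul_kronecker_mul, hQ,
      Matrix.conjTranspose_one, Matrix.one_mul, Matrix.one_kronecker_one]
  -- Compressing `R` to the range of `auxiliaryRows V` leaves the bipartite map unchanged, hence, by
  -- injectivity, also `Θ`; minimality of `r` applies to this realization.
  have hle : r ≤ r' := h.2 r' _ _ (isRealization_iff.mpr
    ⟨hV', hE.comp (isChannel_conjBy hQ1), toBipartite_injective (by
      rw [toBipartite_prePostSupermap, semilocal_eq_of_outputSlice hsl, h.1.toBipartite_eq])⟩)
  have hge : r' ≤ r := by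
    have := (Matrix.rank_mul_le_right Qᴴ Q).trans Q.rank_le_height
    rwa [hQ, Matrix.rank_one, Fintype.card_fin] at this
  obtain rfl := le_antisymm hle hge
  -- Once square, `Q` is unitary, so conjugating `Qᴴ * auxiliaryRows V * P = 1` by it gives the
  -- right inverse.
  have hQ' : Q * Qᴴ = 1 := mul_eq_one_comm.mp hQ
  refine ⟨P * Qᴴ, ?_⟩
  have : Q * (Qᴴ * auxiliaryRows V * P) * Qᴴ = 1 := by rw [hP, Matrix.mul_one, hQ']
  rwa [← Matrix.mul_assoc, ← Matrix.mul_assoc, hQ', Matrix.one_mul, Matrix.mul_assoc] at this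

end StandardForm

/-! ### Conditional unitality -/

section Unital

lemma IsState.traceSnd {A B : Type*} [Fintype A] [Fintype B] {ρ : Matrix (A × B) (A × B) ℂ} (h : IsState ρ) :
    IsState (traceSnd ρ) := by
  refine ⟨?_, (trace_traceSnd ρ).trans h.2⟩
  rw [traceSnd_eq_sum_block]
  exact Matrix.posSemidef_sum _ fun b _ => h.1.submatrix fun a => (a, b)

variable {R A' A B : Type*} [Fintype A'] [Fintype B] [DecidableEq B]

lemma trace_unif [Nonempty B] : (unif B).trace = 1 := isState_unif.2

/-- The state `σ` has to be the reduced output, since `unif B` has trace one. In that form the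
condition is linear and extends from states to all operators. -/
lemma IsConditionallyUnital.apply_kronecker_unif [DecidableEq A'] [Fintype A] [Nonempty B]
    {N : Superop (A' × B) (A × B)} (h : IsConditionallyUnital N) (M : Matrix A' A' ℂ) :
    N (M ⊗ₖ unif B) = traceSnd (N (M ⊗ₖ unif B)) ⊗ₖ unif B := by
  let κ : Matrix A' A' ℂ →ₗ[ℂ] Matrix (A' × B) (A' × B) ℂ :=
    (Matrix.kroneckerBilinear (R := ℂ)).flip (unif B)
  let κ' : Matrix A A ℂ →ₗ[ℂ] Matrix (A × B) (A × B) ℂ :=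
    (Matrix.kroneckerBilinear (R := ℂ)).flip (unif B)
  have : N ∘ₗ κ = κ' ∘ₗ traceSndLinearMap A B ∘ₗ N ∘ₗ κ := by
    refine linearMap_ext_isState fun ρ hρ => ?_
    obtain ⟨σ, -, hσ⟩ := h ρ hρ
    change N (ρ ⊗ₖ unif B) = traceSndLinearMap A B (N (ρ ⊗ₖ unif B)) ⊗ₖ unif B
    rw [hσ, traceSndLinearMap_apply, traceSnd_kronecker, trace_unif, one_smul]
  have hM : N (M ⊗ₖ unif B) = traceSndLinearMap A B (N (M ⊗ₖ unif B)) ⊗ₖ unif B :=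
    LinearMap.congr_fun this M
  rwa [traceSndLinearMap_apply] at hM

/-- The right inverse writes `τ` as a sum of operators `⟨a|V X V†|a'⟩`. The value of `E` on each of
them tensored with `unif B` is a block of `N (X ⊗ u)`, a multiple of `unif B`. -/
lemma isConditionallyUnitalPost_of_rightInverse [Fintype R] [DecidableEq R] [DecidableEq A']
    [Fintype A] [Nonempty B] {V : Matrix (R × A) A' ℂ} {E : Superop (R × B) B} (hE : IsChannel E)
    {P : Matrix (A × A') R ℂ} (hP : auxiliaryRows V * P = 1)
    (h : IsConditionallyUnital (semilocal V E)) : IsConditionallyUnitalPost E := by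
  refine (isConditionallyUnitalPost_iff hE).mpr fun τ hτ => ?_
  -- The blocks of `P τ Pᴴ`, chosen because `auxiliaryRows V` maps `P τ Pᴴ` back to `τ`. They need
  -- not be states, so the linear form of conditional unitality is required.
  let X (a a' : A) : Matrix A' A' ℂ :=
    (P * τ * Pᴴ).submatrix (fun x => (a, x)) fun x => (a', x)
  have hτX : τ = ∑ a, ∑ a', outputSlice V a * X a a' * (outputSlice V a')ᴴ := by
    have h1 : τ = auxiliaryRows V * (P * τ * Pᴴ) * (auxiliaryRows V)ᴴ := by
      calc τ = (auxiliaryRows V * P) * τ * (auxiliaryRows V * P)ᴴ := by simp [hP]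
        _ = _ := by
          rw [Matrix.conjTranspose_mul]
          simp only [Matrix.mul_assoc]
    rw [h1]
    ext r r'
    simp only [Matrix.sum_apply, Matrix.mul_apply (N := (auxiliaryRows V)ᴴ),
      Matrix.mul_apply (M := auxiliaryRows V), Matrix.mul_apply (N := (outputSlice V _)ᴴ),
      Matrix.mul_apply (M := outputSlice V _), Fintype.sum_prod_type, Finset.sum_mul]
    conv_rhs => rw [Finset.sum_comm]
    refine Finset.sum_congr rfl fun a' _ => ?_
    rw [Finset.sum_comm]
    rfl
  let c : A → A → ℂ := fun a a' => traceSnd (semilocal V E (X a a' ⊗ₖ unif B)) a a'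
  have hterm : ∀ a a', E ((outputSlice V a * X a a' * (outputSlice V a')ᴴ) ⊗ₖ unif B) =
      c a a' • unif B := by
    intro a a'
    ext b b'
    have h1 := congrFun (congrFun (h.apply_kronecker_unif (X a a')) (a, b)) (a', b')
    rw [semilocal_apply, Matrix.conjTranspose_kronecker, ← Matrix.mul_kronecker_mul,
      ← Matrix.mul_kronecker_mul, Matrix.conjTranspose_one, Matrix.one_mul, Matrix.mul_one] at h1
    exact h1
  have hEτ : E (τ ⊗ₖ unif B) = (∑ a, ∑ a', c a a') • unif B := by
    let κ : Matrix R R ℂ →ₗ[ℂ] Matrix (R × B) (R × B) ℂ :=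
      (Matrix.kroneckerBilinear (R := ℂ)).flip (unif B)
    have : E (κ τ) = (∑ a, ∑ a', c a a') • unif B := by
      rw [hτX]
      simp only [map_sum, Finset.sum_smul, ← hterm]
      rfl
    exact this
  -- Trace preservation forces the scalar to be `1`.
  have htr := congrArg Matrix.trace hEτ
  rw [hE.2, Matrix.trace_kronecker, hτ.2, Matrix.trace_smul, trace_unif, one_mul, smul_eq_mul,
    mul_one] at htr
  rw [hEτ, ← htr, one_smul]

/-- By linearity `E (Y ⊗ u)` is `Y.trace • u` for every operator `Y`, so each block over `A` of the
output is a multiple of `u`; the multiples form the state on `A`. -/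
lemma isConditionallyUnital_semilocal [DecidableEq A'] [Fintype R] [DecidableEq R] [Fintype A]
    [Nonempty B] {V : Matrix (R × A) A' ℂ} {E : Superop (R × B) B} (hV : IsIsometry V)
    (hE : IsChannel E) (hu : IsConditionallyUnitalPost E) :
    IsConditionallyUnital (semilocal V E) := by
  intro ρ hρ
  have hE' : ∀ Y : Matrix R R ℂ, E (Y ⊗ₖ unif B) = Y.trace • unif B := by
    let κ : Matrix R R ℂ →ₗ[ℂ] Matrix (R × B) (R × B) ℂ :=
      (Matrix.kroneckerBilinear (R := ℂ)).flip (unif B)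
    have : E ∘ₗ κ = (Matrix.traceLinearMap R ℂ ℂ).smulRight (unif B) := by
      refine linearMap_ext_isState fun τ hτ => ?_
      change E (τ ⊗ₖ unif B) = τ.trace • unif B
      rw [(isConditionallyUnitalPost_iff hE).mp hu τ hτ, hτ.2, one_smul]
    exact fun Y => LinearMap.congr_fun this Y
  have hC : semilocal V E (ρ ⊗ₖ unif B) =
      (Matrix.of fun a a' => (outputSlice V a * ρ * (outputSlice V a')ᴴ).trace) ⊗ₖ unif B := by
    ext ⟨a, b⟩ ⟨a', b'⟩
    rw [semilocal_apply, Matrix.conjTranspose_kronecker, ← Matrix.mul_kronecker_mul,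
      ← Matrix.mul_kronecker_mul, Matrix.conjTranspose_one, Matrix.one_mul, Matrix.mul_one, hE']
    rfl
  refine ⟨_, ?_, hC⟩
  -- The matrix of multiples is a state because it is the reduced output of a channel.
  have := ((isChannel_semilocal hV hE).isState (hρ.kronecker isState_unif)).traceSnd
  rwa [hC, traceSnd_kronecker, trace_unif, one_smul] at this

lemma isConditionallyMixing_semilocal [DecidableEq A'] [Fintype R] [DecidableEq R] [Fintype A]
    [Nonempty B] {V : Matrix (R × A) A' ℂ} {E : Superop (R × B) B} (hV : IsIsometry V)
    (hE : IsChannel E) (hu : IsConditionallyUnitalPost E) :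
    IsConditionallyMixing (semilocal V E) :=
  ⟨isChannel_semilocal hV hE, isNonSignalling_semilocal V hE,
    isConditionallyUnital_semilocal hV hE hu⟩

/-- Every conditionally mixing channel comes from a mixing superchannel in standard form. -/
lemma IsConditionallyMixing.exists_standardForm [DecidableEq A'] [Fintype A] [DecidableEq A]
    [Nonempty B] {N : Superop (A' × B) (A × B)} (h : IsConditionallyMixing N) :
    ∃ (Θ : Supermap A B A' B) (r : ℕ) (V : Matrix (Fin r × A) A' ℂ) (E : Superop (Fin r × B) B),
      IsStandardForm Θ r V E ∧ IsConditionallyUnitalPost E ∧ N = semilocal V E := by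
  obtain ⟨hN, hns, hu⟩ := h
  obtain ⟨r₀, V₀, E₀, hV₀, hE₀, rfl⟩ := hns.exists_semilocal hN
  -- The dilation at hand is not known to be minimal, so it is replaced by a standard form of the
  -- same superchannel, which has the same bipartite map.
  obtain ⟨r, V, E, hst⟩ := (isSuperchannel_prePostSupermap hV₀ hE₀).exists_standardForm
  have heq := hst.1.toBipartite_eq
  rw [toBipartite_prePostSupermap] at heq
  obtain ⟨P, hP⟩ := hst.exists_rightInverse
  rw [heq] at hu ⊢
  exact ⟨_, r, V, E, hst, isConditionallyUnitalPost_of_rightInverse hst.1.2.1 hP hu, rfl⟩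

end Unital

end QMix

/-! ### The correspondence between superchannels and bipartite channels -/

theorem theorem14 {A' A B : Type*}
    [Fintype A'] [DecidableEq A'] [Nonempty A'] [Fintype A] [DecidableEq A] [Nonempty A]
    [Fintype B] [DecidableEq B] [Nonempty B] :
    (∀ N : QMix.Superop (A' × B) (A × B), QMix.IsChannel N →
      (QMix.IsNonSignalling N ↔
        ∃ (r : ℕ) (V : Matrix (Fin r × A) A' ℂ) (E : QMix.Superop (Fin r × B) B),
          QMix.IsIsometry V ∧ QMix.IsChannel E ∧ N = QMix.semilocal V E)) ∧
    (∀ N : QMix.Superop (A' × B) (A × B), QMix.IsChannel N →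
      (QMix.IsConditionallyMixing N ↔
        ∃ (r : ℕ) (V : Matrix (Fin r × A) A' ℂ) (E : QMix.Superop (Fin r × B) B),
          QMix.IsIsometry V ∧ QMix.IsChannel E ∧ QMix.IsConditionallyUnitalPost E ∧
            N = QMix.semilocal V E)) ∧
    (∀ Θ : QMix.Supermap A B A' B, QMix.IsSuperchannel Θ →
      ∃ (r : ℕ) (V : Matrix (Fin r × A) A' ℂ) (E : QMix.Superop (Fin r × B) B),
        QMix.IsRealization Θ V E) ∧
    (∃ f : QMix.Supermap A B A' B → QMix.Superop (A' × B) (A × B),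
      (∀ (Θ : QMix.Supermap A B A' B) (r : ℕ) (V : Matrix (Fin r × A) A' ℂ)
          (E : QMix.Superop (Fin r × B) B),
        QMix.IsRealization Θ V E → f Θ = QMix.semilocal V E) ∧
      Set.BijOn f {Θ | QMix.IsSuperchannel Θ}
        {N | QMix.IsChannel N ∧ QMix.IsNonSignalling N} ∧
      Set.BijOn f {Θ | QMix.IsMixing Θ} {N | QMix.IsConditionallyMixing N}) := by
  refine ⟨fun N hN => ⟨fun h => h.exists_semilocal hN, ?_⟩,
    fun N _ => ⟨fun h => ?_, ?_⟩, fun Θ hΘ => hΘ.exists_realization,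
    QMix.toBipartite, fun Θ r V E h => h.toBipartite_eq, ⟨?_, ?_, ?_⟩, ?_, ?_, ?_⟩
  · rintro ⟨r, V, E, -, hE, rfl⟩
    exact QMix.isNonSignalling_semilocal V hE
  · obtain ⟨_, r, V, E, hst, hu, hN⟩ := h.exists_standardForm
    exact ⟨r, V, E, hst.1.1, hst.1.2.1, hu, hN⟩
  · rintro ⟨r, V, E, hV, hE, hu, rfl⟩
    exact QMix.isConditionallyMixing_semilocal hV hE hu
  · exact fun Θ hΘ => ⟨hΘ.isChannel_toBipartite, hΘ.isNonSignalling_toBipartite⟩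
  · exact QMix.toBipartite_injective.injOn
  · rintro N ⟨hN, hns⟩
    obtain ⟨r, V, E, hV, hE, rfl⟩ := hns.exists_semilocal hN
    exact ⟨_, QMix.isSuperchannel_prePostSupermap hV hE, QMix.toBipartite_prePostSupermap V E⟩
  · rintro Θ ⟨-, r, V, E, hst, hu⟩
    change QMix.IsConditionallyMixing _
    rw [hst.1.toBipartite_eq]
    exact QMix.isConditionallyMixing_semilocal hst.1.1 hst.1.2.1 hu
  · exact QMix.toBipartite_injective.injOn
  · intro N hN
    obtain ⟨Θ, r, V, E, hst, hu, rfl⟩ := hN.exists_standardForm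
    exact ⟨Θ, ⟨hst.1.isSuperchannel, r, V, E, hst, hu⟩, hst.1.toBipartite_eq⟩
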